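/- Let $K$ be an algebraically closed field, let $n\ge 0$ and $d\ge 1$ be integers, and assume that $\operatorname{char}(K)$ is $0$ or greater than $d(d-1)$. Let $f\in K[x_1,\dots,x_n,y]$ be an irreducible polynomial of total degree $d$ satisfying Hypothesis (H): (1) $f$ is monic as a polynomial in $y$ and $\deg_y(f)=\deg(f)$; (2) the resultant of $f(0,\dots,0,y)$ and $\frac{\partial f}{\partial y}(0,\dots,0,y)$ is nonzero. Call $a=(a_1,\dots,a_n)\in K^n$ a Bertinian good point for $f$ if for every irreducible factor $\tilde f$ of $f$ over $K$ the bivariate polynomial $\tilde f(a_1x,\dots,a_nx,y)\in K[x,y]$ is irreducible over $K$, and a Bertinian bad point for $f$ otherwise. Let $m=2^{d-1}-1$. Then there exist nonzero polynomials $Q_1,\dots,Q_m\in K[z_1,\dots,z_n]$ of degree at most $2d-1$ such that for every Bertinian bad point $a\in K^n$ for $f$, at least one $Q_i$ vanishes at $a$. -/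

import Mathlib

namespace BertinianCover

open MvPolynomial

/-- Polynomials over `K` in the variables `x₁, …, xₙ, y`: the variable `y` is the one with index
`none`, and `xᵢ` is the one with index `some i`. -/
abbrev PolyXY (n : ℕ) (K : Type*) [CommSemiring K] : Type _ :=
  MvPolynomial (Option (Fin n)) K

variable {n : ℕ} {K : Type*} [Field K]

/-- The univariate polynomial `f(0, …, 0, y) ∈ K[y]`. -/
noncomputable def atZero (f : PolyXY n K) : Polynomial K :=
  aeval (fun o : Option (Fin n) => o.elim Polynomial.X (fun _ => 0)) f

/-- The bivariate polynomial `f(a₁ x, …, aₙ x, y) ∈ K[x][y]`. -/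
noncomputable def restrict (f : PolyXY n K) (a : Fin n → K) : Polynomial (Polynomial K) :=
  aeval (fun o : Option (Fin n) =>
    o.elim Polynomial.X (fun i => Polynomial.C (Polynomial.C (a i) * Polynomial.X))) f

/-- Hypothesis (H) for a non-constant polynomial `f ∈ K[x₁, …, xₙ, y]`. -/
structure HypothesisH (f : PolyXY n K) : Prop where
  /-- `f` is monic as a polynomial in `y` with coefficients in `K[x₁, …, xₙ]`. -/
  monic : (optionEquivLeft K (Fin n) f).Monic
  /-- The degree of `f` in `y` is the total degree of `f`. -/
  degree_y : degreeOf none f = f.totalDegree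
  /-- The resultant of `f(0, y)` and `(∂f/∂y)(0, y)` does not vanish. -/
  resultant_ne_zero : Polynomial.resultant (atZero f) (atZero (pderiv none f)) ≠ 0

/-- `a` is a Bertinian good point for `f` if `g(a₁ x, …, aₙ x, y)` is irreducible in `K[x, y]` for
every irreducible factor `g` of `f`. -/
def BertinianGood (f : PolyXY n K) (a : Fin n → K) : Prop :=
  ∀ g : PolyXY n K, Irreducible g → g ∣ f → Irreducible (restrict g a)

/-- `a` is a Bertinian bad point for `f` if it is not a Bertinian good point for `f`. -/
def BertinianBad (f : PolyXY n K) (a : Fin n → K) : Prop :=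
  ¬ BertinianGood f a

end BertinianCover

/-!
Restrict `f` to the general line `x = z X` through the origin. By Hensel's lemma it splits there
into branches, `f(z X, Y) = ∏ i, (Y - φ i)` with `φ i ∈ K[z]⟦X⟧`, and the coefficient of `X ^ k` in
`φ i` is a form of degree `k` in `z`. If `f(a X, Y)` is reducible, one of its two factors is
`P = ∏ i ∈ T, (Y - φ i)` at `z = a`, with `T` proper and containing a prescribed index, so that
there are `2 ^ (d - 1) - 1` choices for `T`. Comparing total degrees in `X` and `Y`, the numerators
of `dP / P = (G dY + H dX / X) / f` at `z = a` are polynomials of degrees at most `d - 1` and `d`,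
hence all coefficients of `G` and `H` of larger degree vanish at `a`. It remains to find one which
has degree less than `2 d` in `X` and is not identically zero; it serves as the `Q` of `T`.

Otherwise truncating `G` and `H` at `X ^ (2 d)` yields a form over `K[x][Y]` whose curl has degree
at most `2 d - 1` and agrees with that of `dP / P` modulo `X ^ (2 d)`: it is still closed. Its
residue `G / (∂f/∂Y)` along each branch is therefore constant, namely `1` for the branches in `T`
and `0` for the others, where the characteristic has to exceed the Bézout bound `d (d - 1)` on the
degree of the resultant of `f` and `G`. Thus `f` and `G` have a common zero, which is impossible for
irreducible `f` and `G ≠ 0` of smaller degree in `Y`.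
-/

namespace BertinianCover

open Polynomial
open scoped Differential PowerSeries

section DifferentialRings

variable {S : Type*} [CommRing S] [Differential S]

lemma deriv_mul (a b : S) : (a * b)′ = a * b′ + b * a′ :=
  Derivation.leibniz _ a b

lemma derivative_mapCoeffs (P : S[X]) :
    derivative (Differential.mapCoeffs P) = Differential.mapCoeffs (derivative P) := by
  ext j
  simp [coeff_derivative, mul_comm]

lemma deriv_eval (P : S[X]) (s : S) :
    (P.eval s)′ = (Differential.mapCoeffs P).eval s + (derivative P).eval s * s′ := by
  simpa using Differential.deriv_aeval_eq (A := S) s P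

/-- The curl of the logarithmic form `(A dY + B dt) / F`, multiplied by `F ^ 2`; here `∂/∂t` acts
on the coefficients of polynomials in `Y` as the derivation of `S`. -/
noncomputable def curl (F A B : S[X]) : S[X] :=
  F * Differential.mapCoeffs A - A * Differential.mapCoeffs F -
    (F * derivative B - B * derivative F)

lemma curl_sub (F A B A' B' : S[X]) :
    curl F (A - A') (B - B') = curl F A B - curl F A' B' := by
  simp only [curl, map_sub]
  ring

lemma curl_dlog (P Q : S[X]) :
    curl (P * Q) (derivative P * Q) (Differential.mapCoeffs P * Q) = 0 := by
  simp only [curl, Derivation.leibniz, derivative_mul, derivative_mapCoeffs, smul_eq_mul]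
  ring

/-- The residue `A / F'` of a closed form `(A dY + B dt) / F` along a branch of `F = 0` is a
constant; the identity is its vanishing derivative with denominators cleared. -/
lemma deriv_residue_eq_zero_of_curl_eq_zero [IsDomain S] {F A B : S[X]} (h : curl F A B = 0)
    {s : S} (hs : F.eval s = 0) (hs' : (derivative F).eval s ≠ 0) :
    (derivative F).eval s * (A.eval s)′ = A.eval s * ((derivative F).eval s)′ := by
  have slope : (Differential.mapCoeffs F).eval s = -((derivative F).eval s * s′) := by
    have := deriv_eval F s
    rw [hs, map_zero] at this
    linear_combination -this
  have pullback_eq_zero : B.eval s = -(A.eval s * s′) := by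
    have := congr_arg (eval s) h
    simp only [curl, eval_sub, eval_mul, hs, slope, eval_zero] at this
    exact mul_right_cancel₀ hs' (by linear_combination this)
  have h' := congr_arg (fun P => eval s (derivative P)) h
  simp only [curl, derivative_sub, derivative_mul, derivative_mapCoeffs, derivative_zero, eval_sub,
    eval_add, eval_mul, eval_zero, hs, slope, pullback_eq_zero] at h'
  rw [deriv_eval A, deriv_eval (derivative F)]
  linear_combination h'

end DifferentialRings

section Nodal

lemma map_nodal {R S ι : Type*} [CommRing R] [CommRing S] (g : R →+* S) (T : Finset ι)
    (v : ι → R) : (Lagrange.nodal T v).map g = Lagrange.nodal T (g ∘ v) := by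
  simp [Lagrange.nodal, Polynomial.map_prod]

lemma eval_derivative_nodal_ne_zero {S ι : Type*} [CommRing S] [IsDomain S] [Fintype ι]
    {v : ι → S} (hv : Function.Injective v) (l : ι) :
    (derivative (Lagrange.nodal Finset.univ v)).eval (v l) ≠ 0 := by
  classical
  rw [Lagrange.eval_nodal_derivative_eval_node_eq (Finset.mem_univ l), Lagrange.eval_nodal]
  exact Finset.prod_ne_zero_iff.2 fun j hj =>
    sub_ne_zero.2 (hv.ne (Finset.ne_of_mem_erase hj).symm)

variable {S ι : Type*} [CommRing S] [Fintype ι] [DecidableEq ι]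

lemma nodal_mul_nodal_compl (v : ι → S) (T : Finset ι) :
    Lagrange.nodal T v * Lagrange.nodal Tᶜ v = Lagrange.nodal Finset.univ v :=
  Finset.prod_mul_prod_compl T _

/-- With `P` the factor of `F = ∏ i, (Y - v i)` given by the roots indexed by `T`, this is the
numerator of `∂P/∂Y / P` over the denominator `F`. -/
noncomputable def dlogY (v : ι → S) (T : Finset ι) : S[X] :=
  derivative (Lagrange.nodal T v) * Lagrange.nodal Tᶜ v

/-- With `P` the factor of `F = ∏ i, (Y - v i)` given by the roots indexed by `T`, this is the
numerator of `∂P/∂t / P` over the denominator `F`, for the derivation `∂/∂t` of `S`. -/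
noncomputable def dlogX [Differential S] (v : ι → S) (T : Finset ι) : S[X] :=
  Differential.mapCoeffs (Lagrange.nodal T v) * Lagrange.nodal Tᶜ v

lemma curl_dlogY_dlogX [Differential S] (v : ι → S) (T : Finset ι) :
    curl (Lagrange.nodal Finset.univ v) (dlogY v T) (dlogX v T) = 0 := by
  rw [← nodal_mul_nodal_compl v T]
  exact curl_dlog _ _

lemma eval_dlogY_of_notMem (v : ι → S) {T : Finset ι} {l : ι} (hl : l ∉ T) :
    (dlogY v T).eval (v l) = 0 := by
  rw [dlogY, eval_mul, Lagrange.eval_nodal_at_node (by simpa using hl), mul_zero]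

lemma eval_dlogY_of_mem (v : ι → S) {T : Finset ι} {l : ι} (hl : l ∈ T) :
    (dlogY v T).eval (v l) = (derivative (Lagrange.nodal Finset.univ v)).eval (v l) := by
  rw [dlogY, ← nodal_mul_nodal_compl v T, derivative_mul, eval_add,
    eval_mul (p := Lagrange.nodal T v), Lagrange.eval_nodal_at_node hl, zero_mul, add_zero]

end Nodal

section PowerSeries

variable {R : Type*} [CommRing R]

/-- The Euler derivation `X d/dX` on power series; it preserves the order and the degree. -/
noncomputable scoped instance eulerDifferential : Differential R⟦X⟧ where
  deriv :=
    letI := Ring.toIntAlgebra R⟦X⟧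
    ((PowerSeries.X : R⟦X⟧) • PowerSeries.derivative R).restrictScalars ℤ

lemma coeff_euler (s : R⟦X⟧) (k : ℕ) :
    PowerSeries.coeff k s′ = k * PowerSeries.coeff k s := by
  change PowerSeries.coeff k (PowerSeries.X * PowerSeries.derivative R s) = _
  cases k with
  | zero => simp
  | succ k => rw [PowerSeries.coeff_succ_X_mul, PowerSeries.coeff_derivative]; push_cast; ring

lemma euler_X_pow (m : ℕ) : (PowerSeries.X ^ m : R⟦X⟧)′ = (m : R⟦X⟧) * PowerSeries.X ^ m := by
  ext k
  rw [coeff_euler, ← nsmul_eq_mul (m : ℕ) (_ : R⟦X⟧), map_nsmul, PowerSeries.coeff_X_pow,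
    nsmul_eq_mul]
  split_ifs with h <;> simp [h]

lemma constantCoeff_euler (s : R⟦X⟧) : PowerSeries.constantCoeff s′ = 0 := by
  rw [← PowerSeries.coeff_zero_eq_constantCoeff_apply, coeff_euler, Nat.cast_zero, zero_mul]

lemma X_pow_dvd_euler {N : ℕ} {s : R⟦X⟧} (h : PowerSeries.X ^ N ∣ s) : PowerSeries.X ^ N ∣ s′ := by
  rw [PowerSeries.X_pow_dvd_iff] at h ⊢
  exact fun k hk => by rw [coeff_euler, h k hk, mul_zero]

lemma coeff_mul_eq_zero {k : ℕ} {u w : R⟦X⟧} (h : ∀ a b, a + b = k →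
    PowerSeries.coeff a u = 0 ∨ PowerSeries.coeff b w = 0) : PowerSeries.coeff k (u * w) = 0 := by
  rw [PowerSeries.coeff_mul]
  refine Finset.sum_eq_zero fun x hx => ?_
  exact mul_eq_zero_of_ne_zero_imp_eq_zero fun hne => (h _ _ (by simpa using hx)).resolve_left hne

lemma coeff_prod_eq_zero {ι : Type*} (s : Finset ι) (a : ι → ℤ) (p : ι → R⟦X⟧)
    (h : ∀ i ∈ s, ∀ k : ℕ, a i < k → PowerSeries.coeff k (p i) = 0) {k : ℕ}
    (hk : ∑ i ∈ s, a i < k) : PowerSeries.coeff k (∏ i ∈ s, p i) = 0 := by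
  classical
  induction s using Finset.induction_on generalizing k with
  | empty =>
    have : k ≠ 0 := by rintro rfl; simp at hk
    simp [PowerSeries.coeff_one, this]
  | insert i s hi ih =>
    rw [Finset.sum_insert hi] at hk
    rw [Finset.prod_insert hi]
    refine coeff_mul_eq_zero fun b c hbc => ?_
    rcases lt_or_ge (a i) b with hb | hb
    · exact .inl (h i (by simp) b hb)
    · exact .inr (ih (fun j hj => h j (by simp [hj])) (by omega))

/-- The hypothesis `h` says that `w / u` is constant. -/
lemma X_pow_dvd_of_mul_euler_eq [IsDomain R] {u w : R⟦X⟧} (h : u * w′ = w * u′)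
    (hu : PowerSeries.constantCoeff u ≠ 0) (hw : PowerSeries.constantCoeff w = 0) {B : ℕ}
    (hB : ∀ k : ℕ, 0 < k → k ≤ B → (k : R) ≠ 0) : PowerSeries.X ^ (B + 1) ∣ w := by
  suffices ∀ m ≤ B, PowerSeries.X ^ (m + 1) ∣ w from this B le_rfl
  intro m
  induction m with
  | zero => simpa [PowerSeries.X_dvd_iff] using hw
  | succ m ih =>
    intro hm
    obtain ⟨v, rfl⟩ := ih (by omega)
    have reduced : u * ((m + 1 : ℕ) * v + v′) = v * u′ := by
      refine mul_left_cancel₀ (pow_ne_zero (m + 1) PowerSeries.X_ne_zero) ?_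
      rw [deriv_mul, euler_X_pow] at h
      linear_combination h
    have hv : PowerSeries.constantCoeff v = 0 := by
      have := congr_arg PowerSeries.constantCoeff reduced
      simp only [map_mul, map_add, map_natCast, constantCoeff_euler, add_zero, mul_zero] at this
      have hm' := hB (m + 1) m.succ_pos hm
      simpa only [mul_eq_zero, hu, hm', false_or] using this
    rw [pow_succ]
    exact mul_dvd_mul_left _ (PowerSeries.X_dvd_iff.2 hv)

end PowerSeries

/-- The total degree of `P ∈ R⟦X⟧[Y]` in `X` and `Y` is at most `N`. -/
def WeightLE {R : Type*} [CommRing R] (N : ℕ) (P : R⟦X⟧[X]) : Prop :=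
  ∀ j k, N < j + k → PowerSeries.coeff k (P.coeff j) = 0

section Weight

variable {R : Type*} [CommRing R]

namespace WeightLE

variable {M N : ℕ} {P Q : R⟦X⟧[X]}

lemma mono (h : WeightLE M P) (hMN : M ≤ N) : WeightLE N P :=
  fun j k hjk => h j k (by omega)

lemma sub (hP : WeightLE N P) (hQ : WeightLE N Q) : WeightLE N (P - Q) := fun j k h => by
  simp [hP j k h, hQ j k h]

lemma mul (hP : WeightLE M P) (hQ : WeightLE N Q) : WeightLE (M + N) (P * Q) := fun j k h => by
  rw [Polynomial.coeff_mul, map_sum]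
  refine Finset.sum_eq_zero fun x hx => coeff_mul_eq_zero fun a b hab => ?_
  rw [Finset.HasAntidiagonal.mem_antidiagonal] at hx
  rcases lt_or_ge M (x.1 + a) with h1 | h1
  · exact .inl (hP _ _ h1)
  · exact .inr (hQ _ _ (by omega))

lemma derivative (hP : WeightLE N P) : WeightLE (N - 1) (derivative P) := fun j k h => by
  rw [coeff_derivative, ← Nat.cast_succ, mul_comm, ← nsmul_eq_mul, map_nsmul,
    hP (j + 1) k (by omega), smul_zero]

lemma mapCoeffs (hP : WeightLE N P) : WeightLE N (Differential.mapCoeffs P) := fun j k h => by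
  rw [Differential.coeff_mapCoeffs, coeff_euler, hP j k h, mul_zero]

lemma curl {F A B : R⟦X⟧[X]} (hF : WeightLE N F) (hA : WeightLE (N - 1) A)
    (hB : WeightLE N B) : WeightLE (2 * N - 1) (curl F A B) := by
  refine ((hF.mul hA.mapCoeffs).mono ?_).sub ((hA.mul hF.mapCoeffs).mono ?_) |>.sub
    (((hF.mul hB.derivative).mono ?_).sub ((hB.mul hF.derivative).mono ?_)) <;> omega

lemma natDegree_le (hP : WeightLE N P) : P.natDegree ≤ N :=
  natDegree_le_iff_coeff_eq_zero.2 fun j hj => PowerSeries.ext fun k => by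
    rw [hP j k (by omega), map_zero]

lemma eq_zero_of_C_X_pow_dvd (hP : WeightLE M P) (h : C (PowerSeries.X ^ N) ∣ P) (hMN : M < N) :
    P = 0 := by
  ext j k
  rcases lt_or_ge k N with hk | hk
  · exact PowerSeries.X_pow_dvd_iff.1 ((C_dvd_iff_dvd_coeff _ _).1 h j) k hk
  · exact hP j k (by omega)

/-- **Bézout's bound**: plane curves of degrees `m` and `N` meet over at most `m N` abscissae. -/
lemma coeff_resultant_eq_zero {m : ℕ} (hP : WeightLE m P) (hQ : WeightLE N Q) (n : ℕ) {k : ℕ}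
    (hk : m * N < k) : PowerSeries.coeff k (P.resultant Q m n) = 0 := by
  rw [resultant, Matrix.det_apply', map_sum]
  refine Finset.sum_eq_zero fun τ _ => ?_
  rw [← zsmul_eq_mul, map_zsmul]
  refine smul_eq_zero_of_right _ ?_
  refine coeff_prod_eq_zero _
    (fun j => j.addCases (fun j => (N : ℤ) + j) (fun j => m + j) - τ j) _ (fun j _ l hl => ?_) ?_
  · rw [sylvester, Matrix.of_apply]
    induction j using Fin.addCases with
    | left j =>
      simp only [Fin.addCases_left] at hl ⊢
      split_ifs with h
      · exact hQ _ _ (by have := h.1; omega)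
      · simp
    | right j =>
      simp only [Fin.addCases_right] at hl ⊢
      split_ifs with h
      · exact hP _ _ (by have := h.1; omega)
      · simp
  · rw [Finset.sum_sub_distrib, Equiv.sum_comp τ fun i => ((i : ℕ) : ℤ), Fin.sum_univ_add,
      Fin.sum_univ_add]
    simp only [Fin.addCases_left, Fin.addCases_right, Fin.val_castAdd, Fin.val_natAdd,
      Nat.cast_add, Finset.sum_add_distrib, Finset.sum_const, Finset.card_univ, Fintype.card_fin,
      nsmul_eq_mul]
    have : (m * N : ℤ) < k := by exact_mod_cast hk
    linarith

end WeightLE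

lemma C_X_pow_dvd_mapCoeffs {N : ℕ} {P : R⟦X⟧[X]} (h : C (PowerSeries.X ^ N) ∣ P) :
    C (PowerSeries.X ^ N) ∣ Differential.mapCoeffs P := by
  rw [C_dvd_iff_dvd_coeff] at h ⊢
  exact fun j => by rw [Differential.coeff_mapCoeffs]; exact X_pow_dvd_euler (h j)

lemma C_dvd_derivative {c : R} {P : R[X]} (h : C c ∣ P) : C c ∣ derivative P := by
  obtain ⟨Q, rfl⟩ := h
  simp

lemma C_X_pow_dvd_curl (F : R⟦X⟧[X]) {A B : R⟦X⟧[X]} {N : ℕ} (hA : C (PowerSeries.X ^ N) ∣ A)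
    (hB : C (PowerSeries.X ^ N) ∣ B) : C (PowerSeries.X ^ N) ∣ curl F A B :=
  ((C_X_pow_dvd_mapCoeffs hA).mul_left F |>.sub (hA.mul_right _)).sub
    ((C_dvd_derivative hB).mul_left F |>.sub (hB.mul_right _))

end Weight

section Resultant

lemma resultant_ne_zero_of_irreducible {A : Type*} [CommRing A] [IsDomain A]
    [IsIntegrallyClosed A] {F G : A[X]} (hF : F.Monic) (hirr : Irreducible F) (hG : G ≠ 0)
    (hdeg : G.natDegree < F.natDegree) : F.resultant G ≠ 0 := by
  let L := FractionRing A
  have hinj : Function.Injective (algebraMap A L) := IsFractionRing.injective A L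
  have hirr' := (hF.irreducible_iff_irreducible_map_fraction_map (K := L)).1 hirr
  have hG' : G.map (algebraMap A L) ≠ 0 :=
    (Polynomial.map_ne_zero_iff hinj).2 hG
  have coprime : IsCoprime (F.map (algebraMap A L)) (G.map (algebraMap A L)) := by
    refine (dvd_or_isCoprime _ _ hirr').resolve_left fun h => ?_
    have := natDegree_le_of_dvd h hG'
    rw [natDegree_map_eq_of_injective hinj, natDegree_map_eq_of_injective hinj] at this
    omega
  intro h
  have h' : (F.map (algebraMap A L)).resultant (G.map (algebraMap A L)) = 0 := by
    rw [natDegree_map_eq_of_injective hinj, natDegree_map_eq_of_injective hinj,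
      resultant_map_map, h, map_zero]
  exact (resultant_eq_zero_iff.1 h').2 coprime

lemma eval_dvd_resultant {A : Type*} [CommRing A] {F G : A[X]} {s : A} (hs : F.eval s = 0)
    (hF : F.natDegree ≠ 0) : G.eval s ∣ F.resultant G := by
  obtain ⟨p, q, -, -, h⟩ :=
    exists_mul_add_mul_eq_C_resultant F G le_rfl le_rfl (Or.inl hF)
  have := congr_arg (eval s) h
  rw [eval_add, eval_mul, eval_mul, hs, zero_mul, zero_add, eval_C] at this
  exact ⟨_, this.symm⟩

lemma resultant_eq_zero_of_curl_eq_zero {R : Type*} [CommRing R] [IsDomain R] {F G H : R⟦X⟧[X]}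
    {N : ℕ} (hF : WeightLE F.natDegree F) (hG : WeightLE N G) (h : curl F G H = 0) {s : R⟦X⟧}
    (hs : F.eval s = 0) (hs' : PowerSeries.constantCoeff ((derivative F).eval s) ≠ 0)
    (hGs : PowerSeries.constantCoeff (G.eval s) = 0)
    (hchar : ∀ k : ℕ, 0 < k → k ≤ F.natDegree * N → (k : R) ≠ 0) : F.resultant G = 0 := by
  have hF' : (derivative F).eval s ≠ 0 := fun h0 => hs' (by rw [h0, map_zero])
  have hd : F.natDegree ≠ 0 := fun h0 => hF' (by rw [derivative_of_natDegree_zero h0, eval_zero])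
  have high_order : PowerSeries.X ^ (F.natDegree * N + 1) ∣ F.resultant G :=
    (X_pow_dvd_of_mul_euler_eq (deriv_residue_eq_zero_of_curl_eq_zero h hs hF') hs' hGs
      hchar).trans (eval_dvd_resultant hs hd)
  ext k
  rcases lt_or_ge (F.natDegree * N) k with hk | hk
  · exact hF.coeff_resultant_eq_zero hG _ hk
  · exact PowerSeries.X_pow_dvd_iff.1 high_order k (by omega)

end Resultant

section HomogeneousSeries

variable (σ K : Type*) [CommRing K]

/-- Power series in one variable over `K[z]` whose coefficient of degree `k` is homogeneous of
degree `k` in `z`. -/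
def homogSeries : Subring (MvPolynomial σ K)⟦X⟧ where
  carrier := {s | ∀ k, (PowerSeries.coeff k s).IsHomogeneous k}
  mul_mem' {a b} ha hb k := by
    rw [PowerSeries.coeff_mul]
    refine MvPolynomial.IsHomogeneous.sum _ _ _ fun x hx => ?_
    rw [← Finset.HasAntidiagonal.mem_antidiagonal.1 hx]
    exact (ha _).mul (hb _)
  one_mem' k := by
    rw [PowerSeries.coeff_one]
    split_ifs with h
    · rw [h]; exact MvPolynomial.isHomogeneous_one _ _
    · exact MvPolynomial.isHomogeneous_zero _ _ _
  add_mem' {a b} ha hb k := by rw [map_add]; exact (ha k).add (hb k)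
  zero_mem' k := by rw [map_zero]; exact MvPolynomial.isHomogeneous_zero _ _ _
  neg_mem' {a} ha k := by rw [map_neg]; exact (ha k).neg

variable {σ K}

lemma euler_mem_homogSeries {s : (MvPolynomial σ K)⟦X⟧} (hs : s ∈ homogSeries σ K) :
    s′ ∈ homogSeries σ K := fun k => by
  rw [coeff_euler, ← nsmul_eq_mul]
  exact Submodule.smul_of_tower_mem (MvPolynomial.homogeneousSubmodule σ K k) k (hs k)

/-- The embedding `p(x) ↦ p(z₁ X, …, zₙ X)` of `K[x]` into `K[z]⟦X⟧`: the restriction of `p` to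
the general line through the origin. -/
noncomputable def generalLine : MvPolynomial σ K →+* (MvPolynomial σ K)⟦X⟧ :=
  MvPolynomial.eval₂Hom (PowerSeries.C.comp MvPolynomial.C)
    fun i => PowerSeries.C (MvPolynomial.X i) * PowerSeries.X

lemma coeff_generalLine (p : MvPolynomial σ K) (k : ℕ) :
    PowerSeries.coeff k (generalLine p) = MvPolynomial.homogeneousComponent k p := by
  induction p using MvPolynomial.induction_on' with
  | add p q hp hq => simp only [map_add, hp, hq]
  | monomial m r =>
    have h : generalLine (MvPolynomial.monomial m r) =
        PowerSeries.C (MvPolynomial.monomial m r) * PowerSeries.X ^ m.degree := by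
      rw [generalLine, MvPolynomial.coe_eval₂Hom, MvPolynomial.eval₂_monomial]
      simp only [mul_pow, Finsupp.prod, Finset.prod_mul_distrib, Finset.prod_pow_eq_pow_sum,
        RingHom.comp_apply]
      rw [← mul_assoc, Finsupp.degree, MvPolynomial.monomial_eq, Finsupp.prod, map_mul, map_prod]
      simp only [map_pow]
      rfl
    rw [h, PowerSeries.coeff_C_mul, PowerSeries.coeff_X_pow]
    have hm : MvPolynomial.monomial m r ∈ MvPolynomial.homogeneousSubmodule σ K m.degree :=
      MvPolynomial.isHomogeneous_monomial r rfl
    rw [MvPolynomial.homogeneousComponent_of_mem hm]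
    split_ifs <;> simp

lemma generalLine_mem_homogSeries (p : MvPolynomial σ K) : generalLine p ∈ homogSeries σ K :=
  fun k => by
    rw [coeff_generalLine]
    exact MvPolynomial.homogeneousComponent_isHomogeneous k p

lemma generalLine_injective : Function.Injective (generalLine (σ := σ) (K := K)) := by
  refine (injective_iff_map_eq_zero _).2 fun p hp => ?_
  rw [← MvPolynomial.sum_homogeneousComponent p]
  refine Finset.sum_eq_zero fun k _ => ?_
  rw [← coeff_generalLine, hp, map_zero]

lemma constantCoeff_generalLine (p : MvPolynomial σ K) :
    PowerSeries.constantCoeff (generalLine p) =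
      MvPolynomial.C (MvPolynomial.constantCoeff p) := by
  rw [← PowerSeries.coeff_zero_eq_constantCoeff_apply, coeff_generalLine,
    MvPolynomial.homogeneousComponent_zero]
  rfl

/-- The polynomial over `K[x]` obtained from `P ∈ K[z]⟦X⟧[Y]` by truncating the coefficients at
`X ^ N` and setting `X = 1`. -/
noncomputable def dehomogenize (N : ℕ) (P : (MvPolynomial σ K)⟦X⟧[X]) : (MvPolynomial σ K)[X] :=
  ∑ j ∈ Finset.range (P.natDegree + 1),
    monomial j (∑ k ∈ Finset.range N, PowerSeries.coeff k (P.coeff j))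

lemma coeff_dehomogenize (N : ℕ) (P : (MvPolynomial σ K)⟦X⟧[X]) (j : ℕ) :
    (dehomogenize N P).coeff j = ∑ k ∈ Finset.range N, PowerSeries.coeff k (P.coeff j) := by
  rw [dehomogenize, finsetSum_coeff]
  simp only [coeff_monomial]
  rw [Finset.sum_ite_eq']
  split_ifs with h
  · rfl
  · rw [coeff_eq_zero_of_natDegree_lt (by simpa using h)]; simp

/-- Polynomials in `Y` over the ring of homogeneous series. -/
noncomputable abbrev homogPolys (σ K : Type*) [CommRing K] : Subring (MvPolynomial σ K)⟦X⟧[X] :=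
  liftsRing (homogSeries σ K).subtype

section

variable {P : (MvPolynomial σ K)⟦X⟧[X]}

lemma mem_homogPolys : P ∈ homogPolys σ K ↔ ∀ j, P.coeff j ∈ homogSeries σ K := by
  rw [← lifts_iff_liftsRing, lifts_iff_coeff_lifts]
  simp

lemma derivative_mem_homogPolys (hP : P ∈ homogPolys σ K) : derivative P ∈ homogPolys σ K := by
  rw [mem_homogPolys] at hP ⊢
  intro j
  rw [coeff_derivative, ← Nat.cast_succ]
  exact mul_mem (hP _) (natCast_mem _ _)

lemma mapCoeffs_mem_homogPolys (hP : P ∈ homogPolys σ K) :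
    Differential.mapCoeffs P ∈ homogPolys σ K := by
  rw [mem_homogPolys] at hP ⊢
  exact fun j => by
    rw [Differential.coeff_mapCoeffs]
    exact euler_mem_homogSeries (hP j)

lemma eval_mem_homogSeries (hP : P ∈ homogPolys σ K) {s : (MvPolynomial σ K)⟦X⟧}
    (hs : s ∈ homogSeries σ K) : P.eval s ∈ homogSeries σ K := by
  obtain ⟨Q, rfl⟩ := hP
  have := eval_map_apply (p := Q) (homogSeries σ K).subtype ⟨s, hs⟩
  rw [Subring.subtype_apply] at this
  exact this ▸ SetLike.coe_mem _

lemma coeff_map_generalLine_dehomogenize (hP : P ∈ homogPolys σ K) (N j k : ℕ) :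
    PowerSeries.coeff k (((dehomogenize N P).map generalLine).coeff j) =
      if k < N then PowerSeries.coeff k (P.coeff j) else 0 := by
  rw [coeff_map, coeff_generalLine, coeff_dehomogenize, map_sum,
    Finset.sum_congr rfl fun i _ => MvPolynomial.homogeneousComponent_of_mem
      (show PowerSeries.coeff i (P.coeff j) ∈ MvPolynomial.homogeneousSubmodule σ K i from
        mem_homogPolys.1 hP j i), Finset.sum_ite_eq]
  simp only [Finset.mem_range]

lemma C_X_pow_dvd_sub_map_dehomogenize (hP : P ∈ homogPolys σ K) (N : ℕ) :
    C (PowerSeries.X ^ N) ∣ P - (dehomogenize N P).map generalLine := by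
  refine (C_dvd_iff_dvd_coeff _ _).2 fun j => PowerSeries.X_pow_dvd_iff.2 fun k hk => ?_
  rw [coeff_sub, map_sub, coeff_map_generalLine_dehomogenize hP, if_pos hk, sub_self]

lemma weightLE_map_dehomogenize (hP : P ∈ homogPolys σ K) {M N : ℕ}
    (h : ∀ j k, k < N → M < j + k → PowerSeries.coeff k (P.coeff j) = 0) :
    WeightLE M ((dehomogenize N P).map generalLine) := fun j k hjk => by
  rw [coeff_map_generalLine_dehomogenize hP]
  split_ifs with hk
  · exact h j k hk hjk
  · rfl

end

section

variable {ι : Type*} {φ : ι → (MvPolynomial σ K)⟦X⟧}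

lemma nodal_mem_homogPolys (hφ : ∀ i, φ i ∈ homogSeries σ K) (T : Finset ι) :
    Lagrange.nodal T φ ∈ homogPolys σ K :=
  prod_mem fun i _ => sub_mem (X_mem_lifts _) (C_mem_lifts (homogSeries σ K).subtype ⟨φ i, hφ i⟩)

variable [Fintype ι] [DecidableEq ι]

lemma dlogY_mem_homogPolys (hφ : ∀ i, φ i ∈ homogSeries σ K) (T : Finset ι) :
    dlogY φ T ∈ homogPolys σ K :=
  mul_mem (derivative_mem_homogPolys (nodal_mem_homogPolys hφ T)) (nodal_mem_homogPolys hφ _)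

lemma dlogX_mem_homogPolys (hφ : ∀ i, φ i ∈ homogSeries σ K) (T : Finset ι) :
    dlogX φ T ∈ homogPolys σ K :=
  mul_mem (mapCoeffs_mem_homogPolys (nodal_mem_homogPolys hφ T)) (nodal_mem_homogPolys hφ _)

end

end HomogeneousSeries

section Hensel

lemma coeff_eval_trunc {R : Type*} [CommRing R] (P : R⟦X⟧[X]) (s : R⟦X⟧) {k : ℕ} (hk : k ≠ 0) :
    PowerSeries.coeff k (P.eval (PowerSeries.trunc k s : R⟦X⟧)) = PowerSeries.coeff k (P.eval s) -
      PowerSeries.constantCoeff ((derivative P).eval s) * PowerSeries.coeff k s := by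
  let c : R⟦X⟧ := -PowerSeries.mk fun i => PowerSeries.coeff (i + k) s
  have hc : (PowerSeries.trunc k s : R⟦X⟧) = s + PowerSeries.X ^ k * c := by
    linear_combination -PowerSeries.eq_X_pow_mul_shift_add_trunc k s
  have constantCoeff_c : PowerSeries.constantCoeff c = -PowerSeries.coeff k s := by
    rw [map_neg, PowerSeries.constantCoeff_mk, zero_add]
  obtain ⟨q, hq⟩ := P.binomExpansion s (PowerSeries.X ^ k * c)
  have quadratic : PowerSeries.coeff k (q * (PowerSeries.X ^ k * c) ^ 2) = 0 := by
    rw [mul_pow, ← pow_mul, mul_left_comm, PowerSeries.coeff_X_pow_mul', if_neg (by omega)]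
  have linear : PowerSeries.coeff k ((derivative P).eval s * (PowerSeries.X ^ k * c)) =
      -(PowerSeries.constantCoeff ((derivative P).eval s) * PowerSeries.coeff k s) := by
    rw [mul_left_comm, PowerSeries.coeff_X_pow_mul', if_pos le_rfl, Nat.sub_self,
      PowerSeries.coeff_zero_eq_constantCoeff_apply, map_mul, constantCoeff_c, mul_neg]
  rw [hc, hq, map_add, map_add, quadratic, linear, add_zero, sub_eq_add_neg]

variable {σ K : Type*} [Field K] {P : (MvPolynomial σ K)⟦X⟧[X]}

lemma mem_homogSeries_of_eval_eq_zero (hP : P ∈ homogPolys σ K) {s : (MvPolynomial σ K)⟦X⟧}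
    (hs : P.eval s = 0) {r u : K} (hr : PowerSeries.constantCoeff s = MvPolynomial.C r)
    (hu : PowerSeries.constantCoeff ((derivative P).eval s) = MvPolynomial.C u) (hu0 : u ≠ 0) :
    s ∈ homogSeries σ K := by
  intro k
  induction k using Nat.strong_induction_on with
  | _ k ih =>
  rcases eq_or_ne k 0 with rfl | hk
  · rw [PowerSeries.coeff_zero_eq_constantCoeff_apply, hr]
    exact MvPolynomial.isHomogeneous_C _ _
  have trunc_mem : (PowerSeries.trunc k s : (MvPolynomial σ K)⟦X⟧) ∈ homogSeries σ K := by
    intro i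
    rw [coeff_coe, PowerSeries.coeff_trunc]
    split_ifs with hi
    · exact ih i hi
    · exact MvPolynomial.isHomogeneous_zero _ _ _
  have linear := coeff_eval_trunc P s hk
  rw [hs, hu, map_zero, zero_sub] at linear
  have : PowerSeries.coeff k s =
      MvPolynomial.C (-u⁻¹) * PowerSeries.coeff k (P.eval ↑(PowerSeries.trunc k s)) := by
    rw [linear, ← neg_mul_comm, ← map_neg, ← mul_assoc, ← map_mul, neg_neg, inv_mul_cancel₀ hu0,
      map_one, one_mul]
  rw [this]
  exact (eval_mem_homogSeries hP trunc_mem k).C_mul _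

lemma exists_homogSeries_root (hP : P ∈ homogPolys σ K) (hmonic : P.Monic) {p : K[X]}
    (hPp : P.map PowerSeries.constantCoeff = p.map MvPolynomial.C) {r : K} (hr : p.eval r = 0)
    (hr' : (derivative p).eval r ≠ 0) :
    ∃ s ∈ homogSeries σ K, P.eval s = 0 ∧ PowerSeries.constantCoeff s = MvPolynomial.C r := by
  have constantCoeff_eval {s : (MvPolynomial σ K)⟦X⟧}
      (hs : PowerSeries.constantCoeff s = MvPolynomial.C r) :
      PowerSeries.constantCoeff (P.eval s) = MvPolynomial.C (p.eval r) := by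
    rw [← eval_map_apply, hPp, hs, eval_map_apply]
  have constantCoeff_eval_derivative {s : (MvPolynomial σ K)⟦X⟧}
      (hs : PowerSeries.constantCoeff s = MvPolynomial.C r) :
      PowerSeries.constantCoeff ((derivative P).eval s) =
        MvPolynomial.C ((derivative p).eval r) := by
    rw [← eval_map_apply, ← derivative_map, hPp, derivative_map, hs, eval_map_apply]
  have h0 := PowerSeries.constantCoeff_C (MvPolynomial.C (σ := σ) r)
  obtain ⟨s, hs, hsr⟩ := HenselianRing.is_henselian (I := Ideal.span {PowerSeries.X}) P hmonic
    (PowerSeries.C (MvPolynomial.C r))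
    (by rw [Ideal.mem_span_singleton, PowerSeries.X_dvd_iff, constantCoeff_eval h0, hr, map_zero])
    (by
      refine IsUnit.map _ (PowerSeries.isUnit_iff_constantCoeff.2 ?_)
      rw [constantCoeff_eval_derivative h0]
      exact (isUnit_iff_ne_zero.2 hr').map _)
  rw [Ideal.mem_span_singleton, PowerSeries.X_dvd_iff, map_sub, sub_eq_zero, h0] at hsr
  exact ⟨s, mem_homogSeries_of_eval_eq_zero hP hs hsr (constantCoeff_eval_derivative hsr) hr', hs,
    hsr⟩

end Hensel

section Branches

section

variable {σ K ι : Type*} [CommRing K] [Fintype ι]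

/-- The series `φ i` are the branches of `F = 0` over the general line through the origin, and this
cover is unramified at the origin. -/
structure IsBranches (F : (MvPolynomial σ K)[X]) (φ : ι → (MvPolynomial σ K)⟦X⟧) : Prop where
  mem_homogSeries : ∀ i, φ i ∈ homogSeries σ K
  injective_constantCoeff : Function.Injective fun i => PowerSeries.constantCoeff (φ i)
  map_eq_nodal : F.map generalLine = Lagrange.nodal Finset.univ φ

namespace IsBranches

variable {F : (MvPolynomial σ K)[X]} {φ : ι → (MvPolynomial σ K)⟦X⟧}

lemma natDegree_map [Nontrivial K] (hφ : IsBranches F φ) :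
    (F.map generalLine).natDegree = Fintype.card ι := by
  rw [hφ.map_eq_nodal, Lagrange.natDegree_nodal, Finset.card_univ]

lemma monic (hφ : IsBranches F φ) : F.Monic := by
  refine monic_of_injective generalLine_injective ?_
  rw [hφ.map_eq_nodal]
  exact Lagrange.nodal_monic

end IsBranches

end

variable {ι : Type*} [Fintype ι]

lemma constantCoeff_eval_derivative_nodal_ne_zero {R : Type*} [CommRing R] [IsDomain R]
    {v : ι → R⟦X⟧} (hv : Function.Injective fun i => PowerSeries.constantCoeff (v i)) (l : ι) :
    PowerSeries.constantCoeff ((derivative (Lagrange.nodal Finset.univ v)).eval (v l)) ≠ 0 := by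
  rw [← eval_map_apply, ← derivative_map, map_nodal]
  exact eval_derivative_nodal_ne_zero hv l

namespace IsBranches

variable {σ K : Type*} [Field K] {F : (MvPolynomial σ K)[X]} {φ : ι → (MvPolynomial σ K)⟦X⟧}

/-- A closed form `(g dY + h dX/X) / F` has no residue along a branch where `g` vanishes at the
origin, up to the Bézout bound and hence identically. -/
lemma resultant_eq_zero_of_curl_eq_zero (hφ : IsBranches F φ)
    (hchar : ∀ k : ℕ, 0 < k → k ≤ Fintype.card ι * (Fintype.card ι - 1) → (k : K) ≠ 0)
    (hF : WeightLE (Fintype.card ι) (F.map generalLine)) {g h : (MvPolynomial σ K)[X]}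
    (hg : WeightLE (Fintype.card ι - 1) (g.map generalLine))
    (closed : curl (F.map generalLine) (g.map generalLine) (h.map generalLine) = 0) {l : ι}
    (hl : PowerSeries.constantCoeff ((g.map generalLine).eval (φ l)) = 0) :
    F.resultant g = 0 := by
  refine generalLine_injective ?_
  rw [map_zero, ← resultant_map_map, ← natDegree_map_eq_of_injective generalLine_injective F,
    ← natDegree_map_eq_of_injective generalLine_injective g]
  rw [← hφ.natDegree_map] at hF
  refine BertinianCover.resultant_eq_zero_of_curl_eq_zero hF hg closed (s := φ l) ?_ ?_ hl
    fun k hk hk' => ?_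
  · rw [hφ.map_eq_nodal, Lagrange.eval_nodal_at_node (Finset.mem_univ l)]
  · rw [hφ.map_eq_nodal]
    exact constantCoeff_eval_derivative_nodal_ne_zero hφ.injective_constantCoeff l
  · rw [← map_natCast MvPolynomial.C]
    exact MvPolynomial.C_ne_zero.2 (hchar k hk (by rwa [hφ.natDegree_map] at hk'))

end IsBranches

variable [DecidableEq ι]

/-- The numerators of the logarithmic derivatives of the factor indexed by `T` have the total
degrees they would have if this factor were a polynomial whose cofactor is one as well. -/
def HasPolynomialDlog {R : Type*} [CommRing R] (v : ι → R⟦X⟧) (T : Finset ι) : Prop :=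
  WeightLE (Fintype.card ι - 1) (dlogY v T) ∧ WeightLE (Fintype.card ι) (dlogX v T)

lemma map_dlogY {R S : Type*} [CommRing R] [CommRing S] (g : R →+* S) (v : ι → R)
    (T : Finset ι) : (dlogY v T).map g = dlogY (g ∘ v) T := by
  simp only [dlogY, Polynomial.map_mul, ← derivative_map, map_nodal]

lemma map_dlogX {R S : Type*} [CommRing R] [CommRing S] (g : R →+* S) (v : ι → R⟦X⟧)
    (T : Finset ι) :
    (dlogX v T).map (PowerSeries.map g) = dlogX (PowerSeries.map g ∘ v) T := by
  have map_mapCoeffs (P : R⟦X⟧[X]) : (Differential.mapCoeffs P).map (PowerSeries.map g) =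
      Differential.mapCoeffs (P.map (PowerSeries.map g)) := by
    ext j k
    simp [coeff_euler]
  rw [dlogX, Polynomial.map_mul, map_mapCoeffs, map_nodal, map_nodal, dlogX]

lemma constantCoeff_eval_eq_of_dvd_sub {R : Type*} [CommRing R] {P Q : R⟦X⟧[X]} {N : ℕ}
    (hN : N ≠ 0) (h : C (PowerSeries.X ^ N) ∣ P - Q) (s : R⟦X⟧) :
    PowerSeries.constantCoeff (P.eval s) = PowerSeries.constantCoeff (Q.eval s) := by
  have := eval_dvd (x := s) h
  rw [eval_C, eval_sub] at this
  rw [← sub_eq_zero, ← map_sub, ← PowerSeries.X_dvd_iff]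
  exact (dvd_pow_self _ hN).trans this

namespace IsBranches

variable {σ K : Type*} [Field K] {F : (MvPolynomial σ K)[X]} {φ : ι → (MvPolynomial σ K)⟦X⟧}
  {T : Finset ι}

lemma exists_closed_form (hφ : IsBranches F φ) (hF : WeightLE (Fintype.card ι) (F.map generalLine))
    (hT : T.Nonempty)
    (hY : ∀ j k, k < 2 * Fintype.card ι → Fintype.card ι - 1 < j + k →
      PowerSeries.coeff k ((dlogY φ T).coeff j) = 0)
    (hX : ∀ j k, k < 2 * Fintype.card ι → Fintype.card ι < j + k →
      PowerSeries.coeff k ((dlogX φ T).coeff j) = 0) :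
    ∃ g h : (MvPolynomial σ K)[X], WeightLE (Fintype.card ι - 1) (g.map generalLine) ∧
      curl (F.map generalLine) (g.map generalLine) (h.map generalLine) = 0 ∧
      ∀ s, PowerSeries.constantCoeff ((g.map generalLine).eval s) =
        PowerSeries.constantCoeff ((dlogY φ T).eval s) := by
  set d := Fintype.card ι
  have hd : 0 < d := Fintype.card_pos_iff.2 hT.to_type
  have memY := dlogY_mem_homogPolys hφ.mem_homogSeries T
  have memX := dlogX_mem_homogPolys hφ.mem_homogSeries T
  have approxY := C_X_pow_dvd_sub_map_dehomogenize memY (2 * d)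
  have approxX := C_X_pow_dvd_sub_map_dehomogenize memX (2 * d)
  have weightY := weightLE_map_dehomogenize memY hY
  have weightX := weightLE_map_dehomogenize memX hX
  refine ⟨_, dehomogenize (2 * d) (dlogX φ T), weightY, ?_,
    fun s => (constantCoeff_eval_eq_of_dvd_sub (by omega) approxY s).symm⟩
  refine (hF.curl weightY weightX).eq_zero_of_C_X_pow_dvd (N := 2 * d) ?_ (by omega)
  have := C_X_pow_dvd_curl (F.map generalLine) approxY approxX
  rwa [curl_sub, hφ.map_eq_nodal, curl_dlogY_dlogX, zero_sub, dvd_neg, ← hφ.map_eq_nodal] at this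

lemma exists_coeff_ne_zero (hφ : IsBranches F φ) (hirr : Irreducible F)
    (hchar : ∀ k : ℕ, 0 < k → k ≤ Fintype.card ι * (Fintype.card ι - 1) → (k : K) ≠ 0)
    (hF : WeightLE (Fintype.card ι) (F.map generalLine)) (hT : T.Nonempty)
    (hT' : T ≠ Finset.univ) :
    ∃ j k, k < 2 * Fintype.card ι ∧
      (Fintype.card ι - 1 < j + k ∧ PowerSeries.coeff k ((dlogY φ T).coeff j) ≠ 0 ∨
        Fintype.card ι < j + k ∧ PowerSeries.coeff k ((dlogX φ T).coeff j) ≠ 0) := by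
  by_contra! hzero
  obtain ⟨g, h, hg, closed, eval_g⟩ := hφ.exists_closed_form hF hT
    (fun j k hk => (hzero j k hk).1) (fun j k hk => (hzero j k hk).2)
  obtain ⟨i, hi⟩ := hT
  obtain ⟨l, hl⟩ : ∃ l, l ∉ T := by simpa [Finset.eq_univ_iff_forall] using hT'
  have g_ne_zero : g ≠ 0 := fun hg0 =>
    constantCoeff_eval_derivative_nodal_ne_zero hφ.injective_constantCoeff i <| by
      rw [← eval_dlogY_of_mem φ hi, ← eval_g, hg0, Polynomial.map_zero, eval_zero, map_zero]
  have natDegree_g : g.natDegree < F.natDegree := by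
    rw [← natDegree_map_eq_of_injective generalLine_injective F, hφ.natDegree_map,
      ← natDegree_map_eq_of_injective generalLine_injective g]
    exact hg.natDegree_le.trans_lt (Nat.sub_one_lt_of_lt (Fintype.card_pos_iff.2 ⟨i⟩))
  refine resultant_ne_zero_of_irreducible hφ.monic hirr g_ne_zero natDegree_g
    (hφ.resultant_eq_zero_of_curl_eq_zero hchar hF hg closed (l := l) ?_)
  rw [eval_g, eval_dlogY_of_notMem φ hl, map_zero]

theorem exists_certificate (hφ : IsBranches F φ) (hirr : Irreducible F)
    (hchar : ∀ k : ℕ, 0 < k → k ≤ Fintype.card ι * (Fintype.card ι - 1) → (k : K) ≠ 0)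
    (hF : WeightLE (Fintype.card ι) (F.map generalLine)) (hT : T.Nonempty)
    (hT' : T ≠ Finset.univ) :
    ∃ q : MvPolynomial σ K, q ≠ 0 ∧ q.totalDegree ≤ 2 * Fintype.card ι - 1 ∧
      ∀ a : σ → K, HasPolynomialDlog (PowerSeries.map (MvPolynomial.eval a) ∘ φ) T →
        MvPolynomial.eval a q = 0 := by
  obtain ⟨j, k, hk, ⟨hjk, hne⟩ | ⟨hjk, hne⟩⟩ := hφ.exists_coeff_ne_zero hirr hchar hF hT hT'
  · have hmem := mem_homogPolys.1 (dlogY_mem_homogPolys hφ.mem_homogSeries T) j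
    refine ⟨_, hne, (hmem k).totalDegree_le.trans (by omega), fun a ha => ?_⟩
    simpa only [← map_dlogY, coeff_map, PowerSeries.coeff_map] using ha.1 j k hjk
  · have hmem := mem_homogPolys.1 (dlogX_mem_homogPolys hφ.mem_homogSeries T) j
    refine ⟨_, hne, (hmem k).totalDegree_le.trans (by omega), fun a ha => ?_⟩
    simpa only [← map_dlogX, coeff_map, PowerSeries.coeff_map] using ha.2 j k hjk

end IsBranches

end Branches

lemma eq_nodal_of_monic {S ι : Type*} [CommRing S] [IsDomain S] [Fintype ι] {v : ι → S}
    (hv : Function.Injective v) {P : S[X]} (hP : P.Monic) (hdeg : P.natDegree = Fintype.card ι)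
    (h : ∀ i, P.eval (v i) = 0) : P = Lagrange.nodal Finset.univ v := by
  have hdeg' : P.degree = Fintype.card ι := by rw [degree_eq_natDegree hP.ne_zero, hdeg]
  refine eq_of_degree_sub_lt_of_eval_index_eq _ hv.injOn ?_ fun i hi => by
    rw [h, Lagrange.eval_nodal_at_node hi]
  rw [Finset.card_univ, ← hdeg']
  exact degree_sub_lt_left (by rw [hdeg', Lagrange.degree_nodal, Finset.card_univ]) hP.ne_zero
    (by rw [hP.leadingCoeff, Lagrange.nodal_monic.leadingCoeff])

theorem exists_isBranches {σ K : Type*} [Field K] {F : (MvPolynomial σ K)[X]} (hF : F.Monic)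
    (hsplits : (F.map MvPolynomial.constantCoeff).Splits)
    (hsep : (F.map MvPolynomial.constantCoeff).Separable) :
    ∃ φ : (F.map MvPolynomial.constantCoeff).rootSet K → (MvPolynomial σ K)⟦X⟧,
      IsBranches F φ := by
  set p := F.map MvPolynomial.constantCoeff with hp
  have homog : F.map generalLine ∈ homogPolys σ K := mem_homogPolys.2 fun j => by
    rw [coeff_map]
    exact generalLine_mem_homogSeries _
  have fibre : (F.map generalLine).map PowerSeries.constantCoeff = p.map MvPolynomial.C := by
    rw [hp, Polynomial.map_map, Polynomial.map_map]
    exact congr_arg (F.map ·) (RingHom.ext constantCoeff_generalLine)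
  have eval_root (r : p.rootSet K) : p.eval (r : K) = 0 := by
    simpa using aeval_eq_zero_of_mem_rootSet r.2
  choose φ hφ hroot hconst using fun r : p.rootSet K =>
    exists_homogSeries_root homog (hF.map _) fibre (eval_root r)
      (hsep.eval₂_derivative_ne_zero (RingHom.id K) (eval_root r))
  have inj : Function.Injective fun r => PowerSeries.constantCoeff (φ r) := by
    simp only [hconst]
    exact (MvPolynomial.C_injective σ K).comp Subtype.val_injective
  refine ⟨φ, hφ, inj, eq_nodal_of_monic (.of_comp inj) (hF.map _) ?_ hroot⟩
  rw [card_rootSet_eq_natDegree hsep (by simpa using hsplits), hp, hF.natDegree_map,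
    hF.natDegree_map]

section Factors

/-- The pullback `p(X, Y) ↦ p(X Y, Y)` to a chart of the blowup of the origin. It turns the total
degree into the degree in `Y`. -/
noncomputable def blowUp (R : Type*) [CommRing R] : R[X][X] →+* R[X][X] :=
  eval₂RingHom (eval₂RingHom (C.comp C) (C X * X)) X

section

variable {R : Type*} [CommRing R]

lemma coeff_blowUp (p : R[X][X]) (N k : ℕ) :
    ((blowUp R p).coeff N).coeff k = if k ≤ N then (p.coeff (N - k)).coeff k else 0 := by
  induction p using Polynomial.induction_on' with
  | add p q hp hq => simp only [map_add, coeff_add, hp, hq]; split_ifs <;> simp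
  | monomial j s =>
    induction s using Polynomial.induction_on' with
    | add s t hs ht => simp only [map_add, coeff_add, hs, ht]; split_ifs <;> simp
    | monomial l r =>
      have : blowUp R (monomial j (monomial l r)) = monomial (j + l) (monomial l r) := by
        simp only [blowUp, coe_eval₂RingHom, eval₂_monomial, RingHom.comp_apply]
        simp only [← C_mul_X_pow_eq_monomial, map_mul, map_pow]
        ring
      rw [this, coeff_monomial, coeff_monomial]
      split_ifs <;> simp only [coeff_monomial, coeff_zero] <;> grind

lemma natDegree_blowUp_le_iff {p : R[X][X]} {N : ℕ} :
    (blowUp R p).natDegree ≤ N ↔ WeightLE N (p.map coeToPowerSeries.ringHom) := by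
  simp only [natDegree_le_iff_coeff_eq_zero, Polynomial.ext_iff, coeff_blowUp, WeightLE, coeff_map,
    coeToPowerSeries.ringHom_apply, coeff_coe, coeff_zero]
  constructor
  · intro h j k hjk
    simpa using h (j + k) hjk k
  · intro h M hM k
    split_ifs with hk
    · exact h _ _ (by omega)
    · rfl

lemma coeff_blowUp_natDegree_ne_zero [Nontrivial R] {p : R[X][X]} (hp : p.Monic) :
    (blowUp R p).coeff p.natDegree ≠ 0 := fun h => by
  have := coeff_blowUp p p.natDegree 0
  simp [h, hp.coeff_natDegree] at this

lemma WeightLE.of_mul [IsDomain R] {p q : R[X][X]} (hp : p.Monic) (hq : q.Monic)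
    (h : WeightLE (p.natDegree + q.natDegree) ((p * q).map coeToPowerSeries.ringHom)) :
    WeightLE p.natDegree (p.map coeToPowerSeries.ringHom) ∧
      WeightLE q.natDegree (q.map coeToPowerSeries.ringHom) := by
  have hp' := coeff_blowUp_natDegree_ne_zero hp
  have hq' := coeff_blowUp_natDegree_ne_zero hq
  rw [← natDegree_blowUp_le_iff, map_mul, natDegree_mul (fun h0 => hp' (by rw [h0, coeff_zero]))
    fun h0 => hq' (by rw [h0, coeff_zero])] at h
  have := le_natDegree_of_ne_zero hp'
  have := le_natDegree_of_ne_zero hq'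
  rw [← natDegree_blowUp_le_iff, ← natDegree_blowUp_le_iff]
  omega

end

variable {ι : Type*} [Fintype ι] [DecidableEq ι]

lemma exists_eq_nodal_of_mul_eq {S : Type*} [CommRing S] [IsDomain S] {v : ι → S} {P Q : S[X]}
    (hP : P.Monic) (hQ : Q.Monic) (h : P * Q = Lagrange.nodal Finset.univ v) :
    ∃ T : Finset ι, P = Lagrange.nodal T v ∧ Q = Lagrange.nodal Tᶜ v := by
  obtain ⟨T, U, b, c, hTU, disj, hbc, rfl, rfl⟩ :=
    mul_eq_mul_prime_prod (a := 1) (p := fun i => X - C (v i)) (fun i _ => prime_X_sub_C (v i))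
      (h.trans (one_mul _).symm)
  obtain rfl : Tᶜ = U := (IsCompl.of_eq disj.eq_bot hTU).compl_eq
  have hb : b = 1 := (Lagrange.nodal_monic.of_mul_monic_right hP).eq_one_of_isUnit
    (.of_mul_eq_one c hbc.symm)
  have hc : c = 1 := by rw [hb, one_mul] at hbc; exact hbc.symm
  exact ⟨T, by rw [hb, one_mul]; rfl, by rw [hc, one_mul]; rfl⟩

lemma HasPolynomialDlog.of_weightLE {R : Type*} [CommRing R] {v : ι → R⟦X⟧} {T : Finset ι}
    (hT0 : T.Nonempty) (hT : WeightLE T.card (Lagrange.nodal T v))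
    (hTc : WeightLE Tᶜ.card (Lagrange.nodal Tᶜ v)) : HasPolynomialDlog v T := by
  have := T.card_add_card_compl
  have := hT0.card_pos
  exact ⟨(hT.derivative.mul hTc).mono (by omega), (hT.mapCoeffs.mul hTc).mono (by omega)⟩

lemma exists_hasPolynomialDlog_of_not_irreducible {R : Type*} [CommRing R] [IsDomain R]
    {p : R[X][X]} (hp : p.Monic) (hirr : ¬ Irreducible p) {v : ι → R⟦X⟧}
    (hv : p.map coeToPowerSeries.ringHom = Lagrange.nodal Finset.univ v)
    (hpw : WeightLE (Fintype.card ι) (p.map coeToPowerSeries.ringHom)) (i : ι) :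
    ∃ T : Finset ι, i ∈ T ∧ T ≠ Finset.univ ∧ HasPolynomialDlog v T := by
  have natDegree_p : p.natDegree = Fintype.card ι := by
    rw [← hp.natDegree_map coeToPowerSeries.ringHom, hv, Lagrange.natDegree_nodal,
      Finset.card_univ]
  have p_ne_one : p ≠ 1 := fun h => by
    have := Fintype.card_pos_iff.2 ⟨i⟩
    simp [h] at natDegree_p
    omega
  rw [hp.irreducible_iff_natDegree] at hirr
  push Not at hirr
  obtain ⟨q, r, hq, hr, rfl, hq0, hr0⟩ := hirr p_ne_one
  rw [hq.natDegree_mul hr] at natDegree_p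
  rw [← natDegree_p] at hpw
  obtain ⟨hqw, hrw⟩ := WeightLE.of_mul hq hr hpw
  obtain ⟨T, hT, hTc⟩ := exists_eq_nodal_of_mul_eq (hq.map coeToPowerSeries.ringHom)
    (hr.map coeToPowerSeries.ringHom) (by rw [← Polynomial.map_mul, hv])
  rw [← hq.natDegree_map coeToPowerSeries.ringHom, hT, Lagrange.natDegree_nodal] at hq0 hqw
  rw [← hr.natDegree_map coeToPowerSeries.ringHom, hTc, Lagrange.natDegree_nodal] at hr0 hrw
  have nonempty : T.Nonempty := Finset.card_ne_zero.1 hq0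
  have nonempty_compl : Tᶜ.Nonempty := Finset.card_ne_zero.1 hr0
  by_cases hi : i ∈ T
  · refine ⟨T, hi, ?_, .of_weightLE nonempty hqw hrw⟩
    rwa [ne_eq, ← Finset.compl_eq_empty_iff, ← ne_eq, ← Finset.nonempty_iff_ne_empty]
  · refine ⟨Tᶜ, Finset.mem_compl.2 hi, (Finset.compl_ne_univ_iff_nonempty _).2 nonempty,
      .of_weightLE nonempty_compl hrw ?_⟩
    rwa [compl_compl]

end Factors

section Restriction

variable {K : Type*} [Field K] {n : ℕ}

lemma aeval_optionElim {σ R A : Type*} [CommRing R] [CommRing A] [Algebra R A]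
    (g : σ → A) (f : MvPolynomial (Option σ) R) :
    MvPolynomial.aeval (fun o => o.elim X fun i => C (g i)) f =
      (MvPolynomial.optionEquivLeft R σ f).map (MvPolynomial.aeval g).toRingHom := by
  have : MvPolynomial.aeval (fun o => o.elim X fun i => C (g i)) =
      (mapAlgHom (MvPolynomial.aeval g)).comp (MvPolynomial.optionEquivLeft R σ).toAlgHom :=
    MvPolynomial.algHom_ext fun i => by
      cases i <;> simp [MvPolynomial.optionEquivLeft_X_some, MvPolynomial.optionEquivLeft_X_none]
  exact DFunLike.congr_fun this f

lemma restrict_eq_map (f : PolyXY n K) (a : Fin n → K) :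
    restrict f a = (MvPolynomial.optionEquivLeft K (Fin n) f).map
      (MvPolynomial.aeval fun i => C (a i) * X).toRingHom :=
  aeval_optionElim _ f

lemma map_restrict (f : PolyXY n K) (a : Fin n → K) :
    (restrict f a).map coeToPowerSeries.ringHom =
      ((MvPolynomial.optionEquivLeft K (Fin n) f).map generalLine).map
        (PowerSeries.map (MvPolynomial.eval a)) := by
  rw [restrict_eq_map, Polynomial.map_map, Polynomial.map_map]
  congr 1
  exact MvPolynomial.ringHom_ext (fun r => by simp [generalLine]) fun i => by simp [generalLine]

lemma atZero_eq_map (f : PolyXY n K) :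
    atZero f = (MvPolynomial.optionEquivLeft K (Fin n) f).map MvPolynomial.constantCoeff := by
  have aeval_zero : (MvPolynomial.aeval 0 : MvPolynomial (Fin n) K →ₐ[K] K).toRingHom =
      MvPolynomial.constantCoeff :=
    RingHom.ext fun p => by simp
  rw [← aeval_zero, ← aeval_optionElim]
  simp [atZero]

lemma atZero_pderiv (f : PolyXY n K) :
    atZero (MvPolynomial.pderiv none f) = derivative (atZero f) := by
  induction f using MvPolynomial.induction_on with
  | C r => simp [atZero]
  | add p q hp hq => simp only [atZero, map_add] at *; rw [hp, hq]
  | mul_X p i hp =>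
    simp only [atZero, map_mul, Derivation.leibniz, map_add, smul_eq_mul, derivative_mul] at *
    rw [hp]
    cases i with
    | none => simp [add_comm, mul_comm]
    | some i => simp [MvPolynomial.pderiv_X]

lemma weightLE_map_generalLine {f : PolyXY n K}
    (hy : MvPolynomial.degreeOf none f = f.totalDegree) :
    WeightLE f.totalDegree ((MvPolynomial.optionEquivLeft K (Fin n) f).map generalLine) := by
  intro j k hjk
  rw [coeff_map, coeff_generalLine]
  rcases le_or_gt j f.totalDegree with hj | hj
  · have := MvPolynomial.totalDegree_coeff_optionEquivLeft_add_le K _ f j hj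
    exact MvPolynomial.homogeneousComponent_eq_zero _ _ (by omega)
  · rw [coeff_eq_zero_of_natDegree_lt (by rwa [MvPolynomial.natDegree_optionEquivLeft, hy]),
      map_zero]

lemma not_irreducible_restrict_of_bad {f : PolyXY n K} (hf : Irreducible f) {a : Fin n → K}
    (h : BertinianBad f a) : ¬ Irreducible (restrict f a) := fun hirr =>
  h fun _ hg hgf => (((hg.dvd_irreducible_iff_associated hf).1 hgf).map
    (MvPolynomial.aeval (fun o : Option (Fin n) => o.elim X fun i => C (C (a i) * X)) :
      PolyXY n K →ₐ[K] K[X][X])).irreducible_iff.2 hirr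

lemma natCast_ne_zero_of_ringChar {R : Type*} [NonAssocSemiring R] {N : ℕ}
    (h : ringChar R = 0 ∨ N < ringChar R) {k : ℕ} (hk : 0 < k) (hkN : k ≤ N) : (k : R) ≠ 0 := by
  rw [ne_eq, ringChar.spec]
  rcases h with h | h
  · rw [h, zero_dvd_iff]
    exact hk.ne'
  · exact Nat.not_dvd_of_pos_of_lt hk (hkN.trans_lt h)

namespace HypothesisH

variable {f : PolyXY n K}

lemma monic_atZero (hH : HypothesisH f) : (atZero f).Monic := by
  rw [atZero_eq_map]
  exact hH.monic.map _

lemma separable_atZero (hH : HypothesisH f) : (atZero f).Separable := by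
  by_contra h
  have := hH.resultant_ne_zero
  rw [atZero_pderiv] at this
  exact this (resultant_eq_zero_iff.2 ⟨.inl hH.monic_atZero.ne_zero, h⟩)

end HypothesisH

end Restriction

section BadPoints

lemma totalDegree_ne_zero_of_irreducible {σ K : Type*} [Field K] {f : MvPolynomial σ K}
    (hf : Irreducible f) : f.totalDegree ≠ 0 := fun h => by
  rw [MvPolynomial.totalDegree_eq_zero_iff_eq_C] at h
  have hf0 := hf.ne_zero
  rw [h, MvPolynomial.C_ne_zero] at hf0
  rw [h] at hf
  exact hf.not_isUnit ((isUnit_iff_ne_zero.2 hf0).map MvPolynomial.C)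

variable {K : Type*} [Field K] {n : ℕ} {f : PolyXY n K}

lemma HypothesisH.exists_isBranches (hH : HypothesisH f) (hsplits : (atZero f).Splits) :
    ∃ φ : (atZero f).rootSet K → (MvPolynomial (Fin n) K)⟦X⟧,
      IsBranches (MvPolynomial.optionEquivLeft K (Fin n) f) φ := by
  have hsep := hH.separable_atZero
  rw [atZero_eq_map] at hsplits hsep ⊢
  exact BertinianCover.exists_isBranches hH.monic hsplits hsep

lemma HypothesisH.card_eq_totalDegree (hH : HypothesisH f) {ι : Type*} [Fintype ι]
    {φ : ι → (MvPolynomial (Fin n) K)⟦X⟧}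
    (hφ : IsBranches (MvPolynomial.optionEquivLeft K (Fin n) f) φ) :
    Fintype.card ι = f.totalDegree := by
  rw [← hφ.natDegree_map, hφ.monic.natDegree_map, MvPolynomial.natDegree_optionEquivLeft,
    hH.degree_y]

variable {ι : Type*} [Fintype ι] [DecidableEq ι] {φ : ι → (MvPolynomial (Fin n) K)⟦X⟧}

lemma IsBranches.exists_hasPolynomialDlog_of_bad
    (hφ : IsBranches (MvPolynomial.optionEquivLeft K (Fin n) f) φ) (hf : Irreducible f)
    (hF : WeightLE (Fintype.card ι) ((MvPolynomial.optionEquivLeft K (Fin n) f).map generalLine))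
    {a : Fin n → K} (ha : BertinianBad f a) (i : ι) :
    ∃ T : Finset ι, i ∈ T ∧ T ≠ Finset.univ ∧
      HasPolynomialDlog (PowerSeries.map (MvPolynomial.eval a) ∘ φ) T := by
  refine exists_hasPolynomialDlog_of_not_irreducible (p := restrict f a) ?_
    (not_irreducible_restrict_of_bad hf ha) ?_ (fun j k hjk => ?_) i
  · rw [restrict_eq_map]
    exact hφ.monic.map _
  · rw [map_restrict, hφ.map_eq_nodal, map_nodal]
  · rw [map_restrict, coeff_map, PowerSeries.coeff_map, hF j k hjk, map_zero]

end BadPoints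

end BertinianCover

open BertinianCover in
theorem lemma4p3_general {K : Type*} [Field K] (n d : ℕ)
    (hchar : ringChar K = 0 ∨ d * (d - 1) < ringChar K) (f : PolyXY n K) (hirr : Irreducible f)
    (hdeg : f.totalDegree = d) (hH : HypothesisH f) (hsplits : (atZero f).Splits) :
    ∃ Q : Fin (2 ^ (d - 1) - 1) → MvPolynomial (Fin n) K,
      (∀ i, Q i ≠ 0 ∧ (Q i).totalDegree ≤ 2 * d - 1) ∧
        ∀ a : Fin n → K, BertinianBad f a → ∃ i, MvPolynomial.eval a (Q i) = 0 := by
  classical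
  obtain ⟨φ, hφ⟩ := hH.exists_isBranches hsplits
  obtain rfl : Fintype.card ((atZero f).rootSet K) = d :=
    (hH.card_eq_totalDegree hφ).trans hdeg
  have weight := weightLE_map_generalLine hH.degree_y
  rw [hdeg] at weight
  have ⟨i₀⟩ := Fintype.card_pos_iff.1
    (Nat.pos_of_ne_zero (hdeg ▸ totalDegree_ne_zero_of_irreducible hirr))
  have certificate (T : Finset.Ico {i₀} Finset.univ) :=
    hφ.exists_certificate ((MulEquiv.irreducible_iff (MvPolynomial.optionEquivLeft K _)).2 hirr)
      (fun k => natCast_ne_zero_of_ringChar hchar) weight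
      ⟨i₀, Finset.singleton_subset_iff.1 (Finset.mem_Ico.1 T.2).1⟩ (Finset.mem_Ico.1 T.2).2.ne
  choose Q hQ0 hQdeg hQ using certificate
  let e := Finset.equivFinOfCardEq <| (Finset.card_Ico_finset (Finset.subset_univ {i₀})).trans <| by
    rw [Finset.card_univ, Finset.card_singleton]
  refine ⟨Q ∘ e.symm, fun i => ⟨hQ0 _, hQdeg _⟩, fun a ha => ?_⟩
  obtain ⟨T, hi₀, hT, dlog⟩ := hφ.exists_hasPolynomialDlog_of_bad hirr weight ha i₀
  have T_mem : T ∈ Finset.Ico {i₀} Finset.univ := Finset.mem_Ico.2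
    ⟨Finset.singleton_subset_iff.2 hi₀, Finset.ssubset_univ_iff.2 hT⟩
  exact ⟨e ⟨T, T_mem⟩, by simpa using hQ ⟨T, T_mem⟩ a dlog⟩

theorem lemma4p3 {K : Type*} [Field K] [IsAlgClosed K] (n d : ℕ) (hd : 1 ≤ d)
    (hchar : ringChar K = 0 ∨ d * (d - 1) < ringChar K)
    (f : BertinianCover.PolyXY n K) (hirr : Irreducible f) (hdeg : f.totalDegree = d)
    (hH : BertinianCover.HypothesisH f) :
    ∃ Q : Fin (2 ^ (d - 1) - 1) → MvPolynomial (Fin n) K,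
      (∀ i, Q i ≠ 0 ∧ (Q i).totalDegree ≤ 2 * d - 1) ∧
        ∀ a : Fin n → K, BertinianCover.BertinianBad f a → ∃ i, MvPolynomial.eval a (Q i) = 0 :=
  lemma4p3_general n d hchar f hirr hdeg hH (IsAlgClosed.splits _)
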